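/- Let $\mathcal H$ be a nonzero complex Hilbert space. For bounded operators on $\mathcal H$ write $A>0$ if $A$ is positive and invertible, let $\le$ be the Loewner order, and let $I$ be the identity. For a continuous function $f:(0,\infty)\to(0,\infty)$ and $A,B>0$ let $$P_f(A,B):=B^{1/2}f(B^{-1/2}AB^{-1/2})B^{1/2}$$ be the operator perspective of $f$. For $p>0$ consider the implications $$(\mathrm{AH}_{\le})_p:\quad A,B>0,\ P_f(A,B)\le I\implies P_f(A^p,B^p)\le I,$$ $$(\mathrm{AH}_{\ge})_p:\quad A,B>0,\ P_f(A,B)\ge I\implies P_f(A^p,B^p)\ge I.$$ Let $h:(0,\infty)\to(0,\infty)$ be operator monotone with $h(1)=1$, that is, $h$ is continuous and $0<A\le B$ implies $h(A)\le h(B)$ for bounded operators $A,B$ on any infinite-dimensional Hilbert space. Call $h$ power monotone increasing (pmi) if $h(t)^p\le h(t^p)$ for all $t>0$, $p\ge1$, and power monotone decreasing (pmd) if $h(t^p)\le h(t)^p$ for all $t>0$, $p\ge1$. Then the following conditions are equivalent: (i) $h$ is pmi (resp., pmd); (ii) $P_h$ satisfies $(\mathrm{AH}_{\ge})_p$ (resp.,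 $(\mathrm{AH}_{\le})_p$) for all $p\in[1,\infty)$; (iii) $P_{1/h}$ satisfies $(\mathrm{AH}_{\ge})_p$ (resp., $(\mathrm{AH}_{\le})_p$) for all $p\in(0,1]$; (iv) $P_{h(1/t)}$ satisfies $(\mathrm{AH}_{\le})_p$ (resp., $(\mathrm{AH}_{\ge})_p$) for all $p\in(0,1]$; (v) $P_{th(t)}$ satisfies $(\mathrm{AH}_{\le})_p$ (resp., $(\mathrm{AH}_{\ge})_p$) for all $p\in(0,1]$. -/

import Mathlib

universe u

/-- `f` (a real function, considered on `(0, ∞)` only) is operator monotone on `(0, ∞)`: it is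
continuous there, and `0 < A ≤ B` implies `f(A) ≤ f(B)` for bounded operators `A`, `B` on any
infinite-dimensional complex Hilbert space. Here `0 < A` means that `A` is positive and
invertible (`IsStrictlyPositive`), `≤` is the Loewner order, and `f(A)` is the continuous
functional calculus. -/
def OperatorMonotone (f : ℝ → ℝ) : Prop :=
  ContinuousOn f (Set.Ioi 0) ∧
    ∀ (K : Type u) [NormedAddCommGroup K] [InnerProductSpace ℂ K] [CompleteSpace K],
      ¬ FiniteDimensional ℂ K →
        ∀ A B : K →L[ℂ] K, IsStrictlyPositive A → A ≤ B → cfc f A ≤ cfc f B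

/-- The class `OM₊¹` of positive operator monotone functions on `(0, ∞)` with value `1` at `1`. -/
structure IsOMPosOne (h : ℝ → ℝ) : Prop where
  operatorMonotone : OperatorMonotone.{u} h
  pos : ∀ t : ℝ, 0 < t → 0 < h t
  map_one : h 1 = 1

/-- Power monotone increasing: `f(t) ^ p ≤ f(t ^ p)` for all `t > 0` and `p ≥ 1`. -/
def IsPMI (f : ℝ → ℝ) : Prop :=
  ∀ t : ℝ, 0 < t → ∀ p : ℝ, 1 ≤ p → f t ^ p ≤ f (t ^ p)

/-- Power monotone decreasing: `f(t ^ p) ≤ f(t) ^ p` for all `t > 0` and `p ≥ 1`. -/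
def IsPMD (f : ℝ → ℝ) : Prop :=
  ∀ t : ℝ, 0 < t → ∀ p : ℝ, 1 ≤ p → f (t ^ p) ≤ f t ^ p

section Perspective

variable {H : Type*} [NormedAddCommGroup H] [InnerProductSpace ℂ H] [CompleteSpace H]

/-- The operator perspective `P_f(A, B) = B^{1/2} f(B^{-1/2} A B^{-1/2}) B^{1/2}`, used for
positive invertible operators `A`, `B`. -/
noncomputable def operatorPerspective (f : ℝ → ℝ) (A B : H →L[ℂ] H) : H →L[ℂ] H :=
  B ^ (1 / 2 : ℝ) * cfc f (B ^ (-(1 / 2) : ℝ) * A * B ^ (-(1 / 2) : ℝ)) * B ^ (1 / 2 : ℝ)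

end Perspective

/-- The implication `P_f(A, B) ≤ I ⟹ P_f(A^p, B^p) ≤ I` for all positive invertible operators
`A`, `B` on the Hilbert space `H`. -/
def AndoHiaiLE (H : Type*) [NormedAddCommGroup H] [InnerProductSpace ℂ H] [CompleteSpace H]
    (f : ℝ → ℝ) (p : ℝ) : Prop :=
  ∀ A B : H →L[ℂ] H, IsStrictlyPositive A → IsStrictlyPositive B →
    operatorPerspective f A B ≤ 1 → operatorPerspective f (A ^ p) (B ^ p) ≤ 1

/-- The implication `P_f(A, B) ≥ I ⟹ P_f(A^p, B^p) ≥ I` for all positive invertible operators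
`A`, `B` on the Hilbert space `H`. -/
def AndoHiaiGE (H : Type*) [NormedAddCommGroup H] [InnerProductSpace ℂ H] [CompleteSpace H]
    (f : ℝ → ℝ) (p : ℝ) : Prop :=
  ∀ A B : H →L[ℂ] H, IsStrictlyPositive A → IsStrictlyPositive B →
    1 ≤ operatorPerspective f A B → 1 ≤ operatorPerspective f (A ^ p) (B ^ p)

open Set Filter Topology ContinuousLinearMap

section Preliminaries

variable {H K : Type*} [NormedAddCommGroup H] [InnerProductSpace ℂ H]
  [NormedAddCommGroup K] [InnerProductSpace ℂ K]

theorem aeval_comp_eq_comp_aeval {T : K →L[ℂ] K} {A : H →L[ℂ] H} {V : H →L[ℂ] K}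
    (hV : T ∘L V = V ∘L A) (p : Polynomial ℝ) :
    Polynomial.aeval T p ∘L V = V ∘L Polynomial.aeval A p := by
  induction p using Polynomial.induction_on' with
  | add p q hp hq => simp [add_comp, comp_add, hp, hq]
  | monomial n a =>
    have hpow : ∀ n : ℕ, (T ^ n) ∘L V = V ∘L (A ^ n) := by
      intro n
      induction n with
      | zero => ext; simp
      | succ n ih =>
        rw [pow_succ, pow_succ]
        change (T ^ n) ∘L (T ∘L V) = (V ∘L (A ^ n)) ∘L A
        rw [hV, ← ih]
        rfl
    ext x
    have := congrArg (fun S : H →L[ℂ] K => S x) (hpow n)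
    simp only [ContinuousLinearMap.comp_apply] at this
    simp [Polynomial.aeval_monomial, ← Algebra.smul_def, this]

variable [CompleteSpace H] [CompleteSpace K]

theorem IsStrictlyPositive.spectrum_subset_Ioi {A : H →L[ℂ] H} (hA : IsStrictlyPositive A) :
    spectrum ℝ A ⊆ Ioi 0 := fun _ hx => hA.spectrum_pos hx

theorem exists_Icc_of_isCompact_subset_Ioi {s : Set ℝ} (hs : IsCompact s) (hs0 : s ⊆ Ioi 0) :
    ∃ a b : ℝ, 0 < a ∧ s ⊆ Icc a b := by
  have hc : IsCompact (insert 1 s) := hs.insert 1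
  obtain ⟨a, ha, hla⟩ := hc.exists_isLeast (insert_nonempty _ _)
  obtain ⟨b, hb, hlb⟩ := hc.exists_isGreatest (insert_nonempty _ _)
  refine ⟨a, b, ?_, fun x hx => ⟨hla (mem_insert_of_mem _ hx), hlb (mem_insert_of_mem _ hx)⟩⟩
  rcases ha with rfl | ha
  · exact one_pos
  · exact hs0 ha

theorem norm_cfc_sub_aeval_le {A : H →L[ℂ] H} (hA : IsSelfAdjoint A) {a b δ : ℝ}
    (hs : spectrum ℝ A ⊆ Icc a b) {f : ℝ → ℝ} (hf : ContinuousOn f (Icc a b)) (hδ : 0 ≤ δ)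
    {p : Polynomial ℝ} (hp : ∀ x ∈ Icc a b, |p.eval x - f x| < δ) :
    ‖cfc f A - Polynomial.aeval A p‖ ≤ δ := by
  rw [← cfc_polynomial p A, ← cfc_sub _ _ A (hf.mono hs) (by fun_prop)]
  refine norm_cfc_le hδ fun x hx => ?_
  rw [Real.norm_eq_abs, abs_sub_comm]
  exact (hp x (hs hx)).le

/-- The continuous functional calculus respects intertwining relations `T V = V A`. -/
theorem cfc_comp_eq_comp_cfc {T : K →L[ℂ] K} {A : H →L[ℂ] H} (hT : IsStrictlyPositive T)
    (hA : IsStrictlyPositive A) {V : H →L[ℂ] K} (hV : T ∘L V = V ∘L A) {f : ℝ → ℝ}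
    (hf : ContinuousOn f (Ioi 0)) : cfc f T ∘L V = V ∘L cfc f A := by
  obtain ⟨a, b, ha, hab⟩ := exists_Icc_of_isCompact_subset_Ioi
    ((ContinuousFunctionalCalculus.isCompact_spectrum (R := ℝ) T).union
      (ContinuousFunctionalCalculus.isCompact_spectrum (R := ℝ) A))
    (union_subset hT.spectrum_subset_Ioi hA.spectrum_subset_Ioi)
  have hfab : ContinuousOn f (Icc a b) := hf.mono fun x hx => ha.trans_le hx.1
  have hTs := subset_union_left.trans hab
  have hAs := subset_union_right.trans hab
  have hTa : IsSelfAdjoint T := hT.isSelfAdjoint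
  have hAa : IsSelfAdjoint A := hA.isSelfAdjoint
  rw [← sub_eq_zero, ← norm_le_zero_iff]
  refine le_of_forall_pos_le_add fun ε hε => ?_
  rw [zero_add]
  obtain ⟨δ, hδ, hδε⟩ : ∃ δ > 0, δ * ‖V‖ + ‖V‖ * δ ≤ ε := by
    refine ⟨ε / (2 * (‖V‖ + 1)), by positivity, ?_⟩
    have h1 : ε / (2 * (‖V‖ + 1)) * (2 * (‖V‖ + 1)) = ε := by field_simp
    have h2 : 0 < ε / (2 * (‖V‖ + 1)) := by positivity
    nlinarith
  obtain ⟨p, hp⟩ := exists_polynomial_near_of_continuousOn a b f hfab δ hδ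
  have e : cfc f T ∘L V - V ∘L cfc f A
      = (cfc f T - Polynomial.aeval T p) ∘L V - V ∘L (cfc f A - Polynomial.aeval A p) := by
    rw [sub_comp, comp_sub, aeval_comp_eq_comp_aeval hV]
    abel
  rw [e]
  calc _ ≤ ‖(cfc f T - Polynomial.aeval T p) ∘L V‖ + ‖V ∘L (cfc f A - Polynomial.aeval A p)‖ :=
        norm_sub_le _ _
    _ ≤ ‖cfc f T - Polynomial.aeval T p‖ * ‖V‖ + ‖V‖ * ‖cfc f A - Polynomial.aeval A p‖ :=
        add_le_add (opNorm_comp_le _ _) (opNorm_comp_le _ _)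
    _ ≤ δ * ‖V‖ + ‖V‖ * δ := by 
        gcongr
        exacts [norm_cfc_sub_aeval_le hTa hTs hfab hδ.le hp,
          norm_cfc_sub_aeval_le hAa hAs hfab hδ.le hp]
    _ ≤ ε := hδε

end Preliminaries

theorem exists_infiniteDimensional_with_orthogonal_isometries (H : Type u) [NormedAddCommGroup H]
    [InnerProductSpace ℂ H] [CompleteSpace H] [Nontrivial H] :
    ∃ (K : Type u) (_ : NormedAddCommGroup K) (_ : InnerProductSpace ℂ K) (_ : CompleteSpace K)
      (V₀ V₁ : H →L[ℂ] K), ¬ FiniteDimensional ℂ K ∧ adjoint V₀ ∘L V₀ = 1 ∧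
        adjoint V₁ ∘L V₁ = 1 ∧ adjoint V₀ ∘L V₁ = 0 := by
  let V : ℕ → H →L[ℂ] lp (fun _ : ℕ => H) 2 := fun n =>
    LinearMap.mkContinuous
      { toFun := fun x => lp.single 2 n x
        map_add' := fun x y => by
          ext i; by_cases h : i = n <;> simp [lp.single_apply, h]
        map_smul' := fun c x => by
          ext i; by_cases h : i = n <;> simp [lp.single_apply, h] } 1
      (fun x => by simp [lp.norm_single])
  have hV : ∀ n x, V n x = lp.single 2 n x := fun n x => rfl
  have hin : ∀ m n x y, inner ℂ (V m x) (V n y) = if m = n then inner ℂ x y else 0 := by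
    intro m n x y
    rw [hV, hV, lp.inner_single_left, lp.single_apply, Pi.single_apply]
    split_ifs <;> simp
  refine ⟨lp (fun _ : ℕ => H) 2, inferInstance, inferInstance, inferInstance, V 0, V 1, ?_, ?_, ?_,
    ?_⟩
  · intro hfin
    obtain ⟨x, hx⟩ := exists_norm_eq H (zero_le_one)
    have ho : Orthonormal ℂ fun n => V n x := by
      rw [orthonormal_iff_ite]
      intro i j
      rw [hin, inner_self_eq_norm_sq_to_K, hx]
      simp
    have := ho.linearIndependent.finite
    exact not_finite ℕ
  all_goals
    ext x
    refine ext_inner_right ℂ fun y => ?_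
    simp [adjoint_inner_left, hin]

section Block

variable {H K : Type*} [NormedAddCommGroup H] [InnerProductSpace ℂ H] [CompleteSpace H]
  [NormedAddCommGroup K] [InnerProductSpace ℂ K] [CompleteSpace K]

/-- The operator acting as `A` on the range of the isometry `V` and as the scalar `r` on the
orthogonal complement of the range. -/
noncomputable def isometryBlock (V : H →L[ℂ] K) (A : H →L[ℂ] H) (r : ℝ) : K →L[ℂ] K :=
  V ∘L A ∘L adjoint V + r • (1 - V ∘L adjoint V)

theorem conj_adjoint_le_conj_adjoint {A B : H →L[ℂ] H} (h : A ≤ B) (V : H →L[ℂ] K) :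
    V ∘L A ∘L adjoint V ≤ V ∘L B ∘L adjoint V := by
  have := IsPositive.conj_adjoint ((le_def A B).1 h) V
  refine (le_def _ _).2 ?_
  simpa [sub_comp, comp_sub] using this

theorem adjoint_conj_le_adjoint_conj {A B : K →L[ℂ] K} (h : A ≤ B) (V : H →L[ℂ] K) :
    adjoint V ∘L A ∘L V ≤ adjoint V ∘L B ∘L V := by
  simpa using conj_adjoint_le_conj_adjoint h (adjoint V)

theorem isometryBlock_one (V : H →L[ℂ] K) : isometryBlock V 1 1 = 1 := by
  ext x
  simp [isometryBlock]

variable {V : H →L[ℂ] K} (hV : adjoint V ∘L V = 1)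
include hV

theorem adjoint_apply_apply_of_isometry (x : H) : adjoint V (V x) = x := by
  simpa using congrArg (fun S : H →L[ℂ] H => S x) hV

theorem isometryBlock_comp (A : H →L[ℂ] H) (r : ℝ) : isometryBlock V A r ∘L V = V ∘L A := by
  ext x
  simp [isometryBlock, adjoint_apply_apply_of_isometry hV]

theorem isStarProjection_range_of_isometry : IsStarProjection (V ∘L adjoint V) := by
  refine ⟨?_, ?_⟩
  · ext x
    simp [adjoint_apply_apply_of_isometry hV]
  · rw [isSelfAdjoint_iff', adjoint_comp, adjoint_adjoint]

theorem isometryBlock_nonneg {A : H →L[ℂ] H} (hA : 0 ≤ A) {r : ℝ} (hr : 0 ≤ r) :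
    0 ≤ isometryBlock V A r := by
  have h1 := conj_adjoint_le_conj_adjoint hA V
  simp only [zero_comp, comp_zero] at h1
  exact add_nonneg h1 (smul_nonneg hr (isStarProjection_range_of_isometry hV).one_sub.nonneg)

theorem isometryBlock_mul (A B : H →L[ℂ] H) (r s : ℝ) :
    isometryBlock V A r * isometryBlock V B s = isometryBlock V (A * B) (r * s) := by
  ext x
  simp [isometryBlock, adjoint_apply_apply_of_isometry hV, smul_sub, mul_smul]

theorem IsStrictlyPositive.isometryBlock {A : H →L[ℂ] H} (hA : IsStrictlyPositive A) {r : ℝ}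
    (hr : 0 < r) : IsStrictlyPositive (isometryBlock V A r) := by
  refine ⟨isometryBlock_nonneg hV hA.nonneg hr.le, ?_⟩
  obtain ⟨B, hAB, hBA⟩ := isUnit_iff_exists.1 hA.isUnit
  refine isUnit_iff_exists.2 ⟨_root_.isometryBlock V B r⁻¹, ?_, ?_⟩
  · rw [isometryBlock_mul hV, hAB, mul_inv_cancel₀ hr.ne', isometryBlock_one]
  · rw [isometryBlock_mul hV, hBA, inv_mul_cancel₀ hr.ne', isometryBlock_one]

theorem cfc_isometryBlock_comp {A : H →L[ℂ] H} (hA : IsStrictlyPositive A) {r : ℝ} (hr : 0 < r)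
    {f : ℝ → ℝ} (hf : ContinuousOn f (Ioi 0)) :
    cfc f (isometryBlock V A r) ∘L V = V ∘L cfc f A :=
  cfc_comp_eq_comp_cfc (hA.isometryBlock hV hr) hA (isometryBlock_comp hV A r) hf

/-- A nonnegative operator leaving the range of an isometry invariant dominates its part there. -/
theorem conj_adjoint_le_of_comp_eq {S : K →L[ℂ] K} {A : H →L[ℂ] H} (hS : 0 ≤ S)
    (hSV : S ∘L V = V ∘L A) : V ∘L A ∘L adjoint V ≤ S := by
  have hP := isStarProjection_range_of_isometry hV
  set P := V ∘L adjoint V with hPdef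
  have hSP : S * P = V ∘L A ∘L adjoint V := by
    change (S ∘L V) ∘L adjoint V = _
    rw [hSV]; rfl
  have hPSP : P * (S * P) = S * P := by
    rw [hSP]
    ext x
    simp [hPdef, adjoint_apply_apply_of_isometry hV]
  have hPS : P * S = S * P := by
    have h1 := congrArg star hPSP
    simp only [star_mul, hP.isSelfAdjoint.star_eq, (IsSelfAdjoint.of_nonneg hS).star_eq] at h1
    rw [← h1, mul_assoc, hPSP]
  rw [← hSP, ← sub_nonneg]
  have h2 := star_left_conjugate_nonneg hS (1 - P)
  rw [star_sub, star_one, hP.isSelfAdjoint.star_eq] at h2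
  have h3 : (1 - P) * S * (1 - P) = S - S * P - P * S + P * (S * P) := by noncomm_ring
  rwa [h3, hPSP, hPS, sub_add_cancel] at h2

/-- A nonnegative operator is dominated by a block diagonal one whose corner is arbitrarily close
to its own corner. -/
theorem le_isometryBlock {T : K →L[ℂ] K} (hT : 0 ≤ T) {B : H →L[ℂ] H}
    (hB : adjoint V ∘L T ∘L V ≤ B) {ε : ℝ} (hε : 0 < ε) :
    T ≤ isometryBlock V ((1 + ε) • B) ((1 + ε⁻¹) * ‖T‖) := by
  have hP := isStarProjection_range_of_isometry hV
  have hQ := hP.one_sub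
  set P := V ∘L adjoint V with hPdef
  set Q := 1 - P with hQdef
  have hPQ : P + Q = 1 := by simp [hQdef]
  have h1 : P * T * P ≤ V ∘L B ∘L adjoint V := conj_adjoint_le_conj_adjoint hB V
  have h2 : Q * T * Q ≤ ‖T‖ • Q := by
    have := CStarAlgebra.star_left_conjugate_le_norm_smul (a := Q) (b := T)
      (IsSelfAdjoint.of_nonneg hT)
    rwa [hQ.isSelfAdjoint.star_eq, hQ.isIdempotentElem.eq] at this
  obtain ⟨c, hc, rfl⟩ : ∃ c : ℝ, 0 < c ∧ c * c = ε :=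
    ⟨√ε, Real.sqrt_pos.2 hε, Real.mul_self_sqrt hε.le⟩
  have h3 := star_left_conjugate_nonneg hT (c • P - c⁻¹ • Q)
  have h4 : star (c • P - c⁻¹ • Q) = c • P - c⁻¹ • Q := by
    simp [hP.isSelfAdjoint.star_eq, hQ.isSelfAdjoint.star_eq]
  have h5 : (c • P - c⁻¹ • Q) * T * (c • P - c⁻¹ • Q)
      = (c * c) • (P * T * P) + (c * c)⁻¹ • (Q * T * Q) - P * T * Q - Q * T * P := by
    simp only [sub_mul, mul_sub, smul_mul_assoc, mul_smul_comm]
    match_scalars <;> field_simp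
  have h6 : T = P * T * P + P * T * Q + Q * T * P + Q * T * Q := by
    calc T = (P + Q) * T * (P + Q) := by rw [hPQ]; simp
      _ = _ := by noncomm_ring
  rw [h4, h5] at h3
  have h7 : T ≤ (1 + c * c) • (P * T * P) + (1 + (c * c)⁻¹) • (Q * T * Q) := by
    have : ∀ a b d e : K →L[ℂ] K, T = a + b + d + e →
        0 ≤ (c * c) • a + (c * c)⁻¹ • e - b - d → T ≤ (1 + c * c) • a + (1 + (c * c)⁻¹) • e := by
      intro a b d e hT h0
      rw [← sub_nonneg]
      convert h0 using 1
      rw [hT]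
      module
    exact this _ _ _ _ h6 h3
  refine h7.trans ?_
  have e : isometryBlock V ((1 + c * c) • B) ((1 + (c * c)⁻¹) * ‖T‖)
      = (1 + c * c) • (V ∘L B ∘L adjoint V) + (1 + (c * c)⁻¹) • (‖T‖ • Q) := by
    ext x
    simp [isometryBlock, hQdef, hPdef, mul_smul]
  rw [e]
  exact add_le_add (smul_le_smul_of_nonneg_left h1 (by positivity))
    (smul_le_smul_of_nonneg_left h2 (by positivity))

end Block

section Jensen

variable {H : Type u} [NormedAddCommGroup H] [InnerProductSpace ℂ H] [CompleteSpace H]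

theorem cfc_le_cfc_of_forall_perturbation {Z C : H →L[ℂ] H}
    (hZ : IsStrictlyPositive Z) {f : ℝ → ℝ} (hf : ContinuousOn f (Ioi 0))
    (h : ∀ ε : ℝ, 0 < ε → C ≤ cfc f ((1 + ε) • (Z + ε • 1))) : C ≤ cfc f Z := by
  have hpos : ∀ ε ∈ Ici (0 : ℝ), IsStrictlyPositive ((1 + ε) • (Z + ε • (1 : H →L[ℂ] H))) := by
    intro ε hε
    have hε' : (0 : ℝ) ≤ ε := hε
    refine IsStrictlyPositive.smul (by positivity) (hZ.add_nonneg ?_)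
    exact smul_nonneg hε' zero_le_one
  have hcont : ContinuousOn (fun ε : ℝ => cfc f ((1 + ε) • (Z + ε • (1 : H →L[ℂ] H)))) (Ici 0) := by
    refine ContinuousOn.cfc_of_mem_nhdsSet (s := Ioi 0) f ?_ (by fun_prop)
      (fun ε hε => (hpos ε hε).isSelfAdjoint) hf
    rw [isOpen_Ioi.mem_nhdsSet]
    exact iUnion₂_subset fun ε hε => (hpos ε hε).spectrum_subset_Ioi
  have ht : Tendsto (fun ε : ℝ => cfc f ((1 + ε) • (Z + ε • (1 : H →L[ℂ] H)))) (𝓝[>] 0)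
      (𝓝 (cfc f Z)) := by
    have := (hcont 0 self_mem_Ici).tendsto.mono_left (nhdsWithin_mono _ Ioi_subset_Ici_self)
    simpa using this
  exact ge_of_tendsto ht (eventually_mem_nhdsWithin.mono fun ε hε => h ε hε)

/-- Hansen's inequality for positive operator monotone functions on `(0, ∞)`. -/
theorem IsOMPosOne.conj_cfc_le_cfc [Nontrivial H] {h : ℝ → ℝ} (hh : IsOMPosOne.{u} h)
    {X Y Z : H →L[ℂ] H} (hY : IsStrictlyPositive Y) (hZ : IsStrictlyPositive Z)
    (hX : star X * X ≤ 1) (hXY : star X * Y * X ≤ Z) : star X * cfc h Y * X ≤ cfc h Z := by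
  obtain ⟨K, _, _, _, V₀, V₁, hK, h00, h11, h01⟩ :=
    exists_infiniteDimensional_with_orthogonal_isometries H
  obtain ⟨hcont, hmono⟩ := hh.operatorMonotone
  refine cfc_le_cfc_of_forall_perturbation hZ hcont fun ε hε => ?_
  have h10 : adjoint V₁ ∘L V₀ = 0 := by
    have := congrArg adjoint h01
    simpa [adjoint_comp] using this
  have a00 : ∀ x, adjoint V₀ (V₀ x) = x := adjoint_apply_apply_of_isometry h00
  have a11 : ∀ x, adjoint V₁ (V₁ x) = x := adjoint_apply_apply_of_isometry h11
  have a01 : ∀ x, adjoint V₀ (V₁ x) = 0 := fun x => by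
    simpa using congrArg (fun S : H →L[ℂ] H => S x) h01
  have a10 : ∀ x, adjoint V₁ (V₀ x) = 0 := fun x => by
    simpa using congrArg (fun S : H →L[ℂ] H => S x) h10
  set S := CFC.sqrt (1 - star X * X) with hSdef
  have hSs : adjoint S = S := (IsSelfAdjoint.of_nonneg (CFC.sqrt_nonneg _)).star_eq
  have hSS : S * S = 1 - star X * X := CFC.sqrt_mul_sqrt_self _ (sub_nonneg.2 hX)
  have hSS' : ∀ x, S (S x) = x - adjoint X (X x) := fun x => by
    simpa [star_eq_adjoint] using congrArg (fun S : H →L[ℂ] H => S x) hSS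
  set W : H →L[ℂ] K := V₀ ∘L X + V₁ ∘L S with hWdef
  have hW : adjoint W ∘L W = 1 := by
    ext x
    simp [hWdef, hSs, a00, a11, a01, a10, hSS']
  set T := isometryBlock V₀ Y ε with hTdef
  have hT : IsStrictlyPositive T := hY.isometryBlock h00 hε
  have hTW : adjoint W ∘L T ∘L W = star X * Y * X + ε • (S * S) := by
    ext x
    simp [hWdef, hSs, hTdef, isometryBlock, a00, a11, a01, a10, star_eq_adjoint]
  have hB : adjoint W ∘L T ∘L W ≤ Z + ε • 1 := by
    rw [hTW, hSS]
    refine add_le_add hXY (smul_le_smul_of_nonneg_left ?_ hε.le)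
    exact sub_le_self _ (star_mul_self_nonneg X)
  have hTR := le_isometryBlock hW hT.nonneg hB hε
  have hZ' : IsStrictlyPositive ((1 + ε) • (Z + ε • (1 : H →L[ℂ] H))) :=
    IsStrictlyPositive.smul (by positivity) (hZ.add_nonneg (smul_nonneg hε.le zero_le_one))
  have hTn : 0 < (1 + ε⁻¹) * ‖T‖ := by
    have : Nontrivial K := by
      by_contra hn
      rw [not_nontrivial_iff_subsingleton] at hn
      exact hK inferInstance
    have : T ≠ 0 := hT.isUnit.ne_zero
    positivity
  have hle := hmono K hK _ _ hT hTR
  have h1 : V₀ ∘L cfc h Y ∘L adjoint V₀ ≤ cfc h T :=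
    conj_adjoint_le_of_comp_eq h00
      (cfc_nonneg fun x hx => (hh.pos x (hT.spectrum_subset_Ioi hx)).le)
      (cfc_isometryBlock_comp h00 hY hε hcont)
  have h2 := adjoint_conj_le_adjoint_conj (h1.trans hle) W
  have h3 : adjoint W ∘L (V₀ ∘L cfc h Y ∘L adjoint V₀) ∘L W = star X * cfc h Y * X := by
    ext x
    simp [hWdef, a00, a01, a10, star_eq_adjoint]
  rw [h3, cfc_isometryBlock_comp hW hZ' hTn hcont, ← comp_assoc, hW] at h2
  exact h2

/-- The reversed form of Hansen's inequality, for expansive invertible `X`. -/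
theorem IsOMPosOne.cfc_le_conj_cfc [Nontrivial H] {h : ℝ → ℝ} (hh : IsOMPosOne.{u} h)
    {X Y Z : H →L[ℂ] H} (hY : IsStrictlyPositive Y) (hZ : IsStrictlyPositive Z) (hXu : IsUnit X)
    (hX : 1 ≤ star X * X) (hXY : Z ≤ star X * Y * X) : cfc h Z ≤ star X * cfc h Y * X := by
  obtain ⟨u, rfl⟩ := hXu
  have hc : ∀ A B : H →L[ℂ] H, A ≤ star (u : H →L[ℂ] H) * B * u →
      star (↑u⁻¹ : H →L[ℂ] H) * A * ↑u⁻¹ ≤ B := by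
    intro A B hAB
    have := star_left_conjugate_le_conjugate hAB (↑u⁻¹ : H →L[ℂ] H)
    rwa [show star (↑u⁻¹ : H →L[ℂ] H) * (star (u : H →L[ℂ] H) * B * u) * ↑u⁻¹
      = star ((u : H →L[ℂ] H) * ↑u⁻¹) * B * (u * ↑u⁻¹) by rw [star_mul]; simp only [mul_assoc],
      Units.mul_inv, star_one, one_mul, mul_one] at this
  have h1 := hc 1 1 (by simpa using hX)
  rw [mul_one] at h1
  have h2 := star_left_conjugate_le_conjugate (hh.conj_cfc_le_cfc hZ hY h1 (hc _ _ hXY))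
    (u : H →L[ℂ] H)
  rwa [show star (u : H →L[ℂ] H) * (star (↑u⁻¹ : H →L[ℂ] H) * cfc h Z * ↑u⁻¹) * u
      = star ((↑u⁻¹ : H →L[ℂ] H) * u) * cfc h Z * (↑u⁻¹ * u) by
        rw [star_mul]; simp only [mul_assoc],
      Units.inv_mul, star_one, one_mul, mul_one] at h2

end Jensen

section RpowCalculus

variable {H : Type*} [NormedAddCommGroup H] [InnerProductSpace ℂ H] [CompleteSpace H]
  {A B C : H →L[ℂ] H}

theorem rpow_mul_rpow (hB : IsStrictlyPositive B) (x y : ℝ) : B ^ x * B ^ y = B ^ (x + y) :=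
  (CFC.rpow_add hB.isUnit).symm

theorem star_rpow (B : H →L[ℂ] H) (x : ℝ) : star (B ^ x) = B ^ x :=
  (IsSelfAdjoint.of_nonneg CFC.rpow_nonneg).star_eq

theorem rpow_conj_le_rpow_conj (B : H →L[ℂ] H) (x : ℝ) {S T : H →L[ℂ] H} (h : S ≤ T) :
    B ^ x * S * B ^ x ≤ B ^ x * T * B ^ x := by
  simpa [star_rpow] using star_left_conjugate_le_conjugate h (B ^ x)

theorem rpow_conj_rpow_conj (hB : IsStrictlyPositive B) (x y : ℝ) (S : H →L[ℂ] H) :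
    B ^ x * (B ^ y * S * B ^ y) * B ^ x = B ^ (x + y) * S * B ^ (x + y) := by
  calc B ^ x * (B ^ y * S * B ^ y) * B ^ x = B ^ x * B ^ y * S * (B ^ y * B ^ x) := by
        simp only [mul_assoc]
    _ = B ^ (x + y) * S * B ^ (x + y) := by
        rw [rpow_mul_rpow hB, rpow_mul_rpow hB, add_comm y x]

theorem rpow_conj_cancel (hB : IsStrictlyPositive B) {x y : ℝ} (hxy : x + y = 0)
    (S : H →L[ℂ] H) : B ^ x * (B ^ y * S * B ^ y) * B ^ x = S := by
  rw [rpow_conj_rpow_conj hB, hxy, CFC.rpow_zero B hB.nonneg, one_mul, mul_one]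

theorem IsStrictlyPositive.rpow_conj (hB : IsStrictlyPositive B) (hA : IsStrictlyPositive A)
    (x : ℝ) : IsStrictlyPositive (B ^ x * A * B ^ x) :=
  IsStrictlyPositive.conjugate_of_isUnit_of_isSelfAdjoint _ _ (hB.rpow B x).isUnit
    (star_rpow B x) hA

theorem rpow_neg_one_le_rpow_neg_one_iff (hA : IsStrictlyPositive A) (hB : IsStrictlyPositive B) :
    A ^ (-1 : ℝ) ≤ B ^ (-1 : ℝ) ↔ B ≤ A := by
  refine ⟨fun h => ?_, fun h => CStarAlgebra.rpow_neg_one_le_rpow_neg_one h hB⟩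
  have := CStarAlgebra.rpow_neg_one_le_rpow_neg_one h (hA.rpow A (-1))
  rwa [CFC.rpow_rpow _ _ _ (by norm_num) hA, CFC.rpow_rpow _ _ _ (by norm_num) hB,
    neg_one_mul, neg_neg, CFC.rpow_one _ hA.nonneg, CFC.rpow_one _ hB.nonneg] at this

theorem rpow_le_rpow_of_nonpos (hA : IsStrictlyPositive A) (h : A ≤ B) {q : ℝ} (hq : -1 ≤ q)
    (hq0 : q ≤ 0) : B ^ q ≤ A ^ q := by
  have hB : IsStrictlyPositive B := hA.of_le h
  rcases hq0.eq_or_lt with rfl | hq0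
  · rw [CFC.rpow_zero _ hA.nonneg, CFC.rpow_zero _ hB.nonneg]
  have h1 := CFC.rpow_le_rpow (p := -q) ⟨by linarith, by linarith⟩ h
  have h2 := CStarAlgebra.rpow_neg_one_le_rpow_neg_one h1 (hA.rpow A _)
  have hq' : -q ≠ 0 := by linarith
  rwa [CFC.rpow_rpow _ _ _ hq' hA, CFC.rpow_rpow _ _ _ hq' hB, mul_neg_one, neg_neg] at h2

theorem IsStrictlyPositive.cfc_of_pos (hC : IsStrictlyPositive C) {k : ℝ → ℝ}
    (hk : ContinuousOn k (Ioi 0)) (hk0 : ∀ t, 0 < t → 0 < k t) : IsStrictlyPositive (cfc k C) := by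
  have hs := hC.spectrum_subset_Ioi
  refine ⟨cfc_nonneg fun x hx => (hk0 x (hs hx)).le, ?_⟩
  rw [isUnit_cfc_iff k C (hk.mono hs) hC.isSelfAdjoint]
  exact fun x hx => (hk0 x (hs hx)).ne'

theorem cfc_mul_cfc_of_continuousOn (hC : IsStrictlyPositive C) {f g : ℝ → ℝ}
    (hf : ContinuousOn f (Ioi 0)) (hg : ContinuousOn g (Ioi 0)) :
    cfc f C * cfc g C = cfc (fun t => f t * g t) C :=
  (cfc_mul f g C (hf.mono hC.spectrum_subset_Ioi) (hg.mono hC.spectrum_subset_Ioi)).symm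

theorem cfc_rpow_of_continuousOn (hC : IsStrictlyPositive C) {k : ℝ → ℝ}
    (hk : ContinuousOn k (Ioi 0)) (hk0 : ∀ t, 0 < t → 0 < k t) (q : ℝ) :
    cfc k C ^ q = cfc (fun t => k t ^ q) C :=
  CFC.cfc_rpow (fun x hx => hk0 x (hC.spectrum_subset_Ioi hx)) (hk.mono hC.spectrum_subset_Ioi)
    hC.isSelfAdjoint

theorem continuousOn_rpow_Ioi (q : ℝ) : ContinuousOn (fun t : ℝ => t ^ q) (Ioi 0) :=
  continuousOn_id.rpow_const fun _ hx => Or.inl (ne_of_gt hx)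

theorem ContinuousOn.rpow_of_pos {k : ℝ → ℝ} (hk : ContinuousOn k (Ioi 0))
    (hk0 : ∀ t, 0 < t → 0 < k t) (q : ℝ) : ContinuousOn (fun t => k t ^ q) (Ioi 0) :=
  hk.rpow_const fun x hx => Or.inl (hk0 x hx).ne'

theorem cfc_rpow_arg (hC : IsStrictlyPositive C) {f : ℝ → ℝ} (hf : ContinuousOn f (Ioi 0))
    (p : ℝ) : cfc f (C ^ p) = cfc (fun t => f (t ^ p)) C := by
  have hs := hC.spectrum_subset_Ioi
  rw [CFC.rpow_eq_cfc_real hC.nonneg, ← cfc_comp' f (fun t => t ^ p) C ?_ ?_ hC.isSelfAdjoint]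
  · refine hf.mono ?_
    rintro _ ⟨x, hx, rfl⟩
    exact Real.rpow_pos_of_pos (hs hx) p
  · exact (continuousOn_rpow_Ioi p).mono hs

theorem cfc_mono_of_pos (hC : IsStrictlyPositive C) {f g : ℝ → ℝ} (hf : ContinuousOn f (Ioi 0))
    (hg : ContinuousOn g (Ioi 0)) (h : ∀ t, 0 < t → f t ≤ g t) : cfc f C ≤ cfc g C :=
  cfc_mono (fun x hx => h x (hC.spectrum_subset_Ioi hx)) (hf.mono hC.spectrum_subset_Ioi)
    (hg.mono hC.spectrum_subset_Ioi)

theorem cfc_congr_of_pos (hC : IsStrictlyPositive C) {f g : ℝ → ℝ}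
    (h : ∀ t, 0 < t → f t = g t) : cfc f C = cfc g C :=
  cfc_congr fun x hx => h x (hC.spectrum_subset_Ioi hx)

theorem cfc_mul_star_self_mul {G : H →L[ℂ] H} (hG : IsUnit G) {f : ℝ → ℝ}
    (hf : ContinuousOn f (Ioi 0)) : cfc f (G * star G) * G = G * cfc f (star G * G) := by
  have h1 : IsStrictlyPositive (G * star G) :=
    (hG.mul hG.star).isStrictlyPositive (mul_star_self_nonneg G)
  have h2 : IsStrictlyPositive (star G * G) :=
    (hG.star.mul hG).isStrictlyPositive (star_mul_self_nonneg G)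
  exact cfc_comp_eq_comp_cfc h1 h2 (mul_assoc G (star G) G) hf

theorem mul_star_self_rpow {G : H →L[ℂ] H} (hG : IsUnit G) (q : ℝ) :
    (G * star G) ^ (q + 1) = G * (star G * G) ^ q * star G := by
  have h1 : IsStrictlyPositive (G * star G) :=
    (hG.mul hG.star).isStrictlyPositive (mul_star_self_nonneg G)
  rw [← rpow_mul_rpow h1, CFC.rpow_one _ h1.nonneg, CFC.rpow_eq_cfc_real h1.nonneg, ← mul_assoc,
    cfc_mul_star_self_mul hG (continuousOn_rpow_Ioi q),
    ← CFC.rpow_eq_cfc_real (star_mul_self_nonneg G)]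

/-- The power `A ^ p` in terms of `B` and `C = B ^ (-1/2) * A * B ^ (-1/2)`. -/
theorem rpow_conj_rpow_eq (hB : IsStrictlyPositive B) (hC : IsStrictlyPositive C) (q : ℝ) :
    (B ^ (1 / 2 : ℝ) * C * B ^ (1 / 2 : ℝ)) ^ (q + 1)
      = B ^ (1 / 2 : ℝ) * (C ^ (1 / 2 : ℝ) * (C ^ (1 / 2 : ℝ) * B * C ^ (1 / 2 : ℝ)) ^ q
          * C ^ (1 / 2 : ℝ)) * B ^ (1 / 2 : ℝ) := by
  have hCC : C ^ (1 / 2 : ℝ) * C ^ (1 / 2 : ℝ) = C := by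
    rw [rpow_mul_rpow hC, add_halves, CFC.rpow_one _ hC.nonneg]
  have hBB : B ^ (1 / 2 : ℝ) * B ^ (1 / 2 : ℝ) = B := by
    rw [rpow_mul_rpow hB, add_halves, CFC.rpow_one _ hB.nonneg]
  have := mul_star_self_rpow ((hB.rpow B (1 / 2)).isUnit.mul (hC.rpow C (1 / 2)).isUnit) q
  rw [star_mul, star_rpow, star_rpow] at this
  generalize B ^ (1 / 2 : ℝ) = b at *
  generalize C ^ (1 / 2 : ℝ) = c at *
  rw [← hCC, ← hBB]
  simpa only [mul_assoc] using this

end RpowCalculus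

section Perspective

variable {H : Type*} [NormedAddCommGroup H] [InnerProductSpace ℂ H] [CompleteSpace H]
  {A B C : H →L[ℂ] H}

theorem rpow_neg_one_eq_of_mul_eq_one (hA : IsStrictlyPositive A) {T : H →L[ℂ] H}
    (h : A * T = 1) : A ^ (-1 : ℝ) = T := by
  have h1 : A ^ (-1 : ℝ) * A = 1 := by
    nth_rewrite 2 [← CFC.rpow_one A hA.nonneg]
    rw [rpow_mul_rpow hA, neg_add_cancel, CFC.rpow_zero _ hA.nonneg]
  calc A ^ (-1 : ℝ) = A ^ (-1 : ℝ) * (A * T) := by rw [h, mul_one]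
    _ = T := by rw [← mul_assoc, h1, one_mul]

theorem rpow_conj_mul_rpow_conj (hB : IsStrictlyPositive B) {x y : ℝ} (hxy : x + y = 0)
    (S T : H →L[ℂ] H) :
    (B ^ x * S * B ^ x) * (B ^ y * T * B ^ y) = B ^ x * (S * T) * B ^ y := by
  calc (B ^ x * S * B ^ x) * (B ^ y * T * B ^ y)
      = B ^ x * S * (B ^ x * B ^ y) * T * B ^ y := by simp only [mul_assoc]
    _ = B ^ x * (S * T) * B ^ y := by
        rw [rpow_mul_rpow hB, hxy, CFC.rpow_zero _ hB.nonneg, mul_one]; simp only [mul_assoc]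

theorem rpow_conj_rpow_neg_one (hB : IsStrictlyPositive B) (hA : IsStrictlyPositive A) {x y : ℝ}
    (hxy : x + y = 0) : (B ^ x * A * B ^ x) ^ (-1 : ℝ) = B ^ y * A ^ (-1 : ℝ) * B ^ y := by
  refine rpow_neg_one_eq_of_mul_eq_one (hB.rpow_conj hA x) ?_
  have h1 : A * A ^ (-1 : ℝ) = 1 := by
    nth_rewrite 1 [← CFC.rpow_one A hA.nonneg]
    rw [rpow_mul_rpow hA, add_neg_cancel, CFC.rpow_zero _ hA.nonneg]
  rw [rpow_conj_mul_rpow_conj hB hxy, h1, mul_one, rpow_mul_rpow hB, hxy,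
    CFC.rpow_zero _ hB.nonneg]

theorem rpow_neg_one_le_one_iff (hA : IsStrictlyPositive A) : A ^ (-1 : ℝ) ≤ 1 ↔ 1 ≤ A := by
  simpa using rpow_neg_one_le_rpow_neg_one_iff hA (isStrictlyPositive_one (A := H →L[ℂ] H))

variable {f : ℝ → ℝ} (hf : ContinuousOn f (Ioi 0)) (hf0 : ∀ t, 0 < t → 0 < f t)

include hf hf0 in
theorem isStrictlyPositive_operatorPerspective (hA : IsStrictlyPositive A)
    (hB : IsStrictlyPositive B) : IsStrictlyPositive (operatorPerspective f A B) :=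
  hB.rpow_conj ((hB.rpow_conj hA _).cfc_of_pos hf hf0) _

theorem one_le_operatorPerspective_iff (hB : IsStrictlyPositive B) :
    1 ≤ operatorPerspective f A B ↔
      B ^ (-1 : ℝ) ≤ cfc f (B ^ (-(1 / 2) : ℝ) * A * B ^ (-(1 / 2) : ℝ)) := by
  unfold operatorPerspective
  constructor
  · intro h
    have := rpow_conj_le_rpow_conj B (-(1 / 2)) h
    rw [rpow_conj_cancel hB (by norm_num), mul_one, rpow_mul_rpow hB] at this
    norm_num at this ⊢
    exact this
  · intro h
    have := rpow_conj_le_rpow_conj B (1 / 2) h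
    rw [rpow_mul_rpow hB, rpow_mul_rpow hB] at this
    norm_num at this ⊢
    rwa [CFC.rpow_zero _ hB.nonneg] at this

theorem ContinuousOn.one_div_of_pos (hf : ContinuousOn f (Ioi 0)) (hf0 : ∀ t, 0 < t → 0 < f t) :
    ContinuousOn (fun t => 1 / f t) (Ioi 0) :=
  continuousOn_const.div hf fun x hx => (hf0 x hx).ne'

theorem ContinuousOn.comp_one_div (hf : ContinuousOn f (Ioi 0)) :
    ContinuousOn (fun t => f (1 / t)) (Ioi 0) :=
  hf.comp (continuousOn_const.div continuousOn_id fun _ hx => (ne_of_gt hx))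
    fun _ hx => mem_Ioi.2 (one_div_pos.2 (mem_Ioi.1 hx))

include hf hf0 in
theorem one_le_operatorPerspective_one_div_iff (hA : IsStrictlyPositive A)
    (hB : IsStrictlyPositive B) :
    1 ≤ operatorPerspective (fun t => 1 / f t) A B ↔
      cfc f (B ^ (-(1 / 2) : ℝ) * A * B ^ (-(1 / 2) : ℝ)) ≤ B := by
  have hC := hB.rpow_conj hA (-(1 / 2))
  rw [one_le_operatorPerspective_iff hB]
  have : (fun t => 1 / f t) = fun t => f t ^ (-1 : ℝ) := by
    ext t; rw [Real.rpow_neg_one, one_div]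
  rw [this, ← cfc_rpow_of_continuousOn hC hf hf0,
    rpow_neg_one_le_rpow_neg_one_iff hB (hC.cfc_of_pos hf hf0)]

include hf hf0 in
theorem operatorPerspective_dual (hA : IsStrictlyPositive A) (hB : IsStrictlyPositive B) :
    operatorPerspective (fun t => 1 / f (1 / t)) (A ^ (-1 : ℝ)) (B ^ (-1 : ℝ))
      = operatorPerspective f A B ^ (-1 : ℝ) := by
  have hC := hB.rpow_conj hA (-(1 / 2))
  unfold operatorPerspective
  rw [rpow_conj_rpow_neg_one hB (hC.cfc_of_pos hf hf0) (add_neg_cancel _),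
    CFC.rpow_rpow B _ _ (by norm_num) hB, CFC.rpow_rpow B _ _ (by norm_num) hB,
    show ((-1 : ℝ) * -(1 / 2)) = 1 / 2 by norm_num, show (-1 : ℝ) * (1 / 2) = -(1 / 2) by norm_num,
    ← rpow_conj_rpow_neg_one hB hA (neg_add_cancel _),
    cfc_rpow_arg hC (hf.comp_one_div.one_div_of_pos fun t ht => hf0 _ (one_div_pos.2 ht)),
    cfc_rpow_of_continuousOn hC hf hf0]
  simp only [Real.rpow_neg_one, one_div, inv_inv]

include hf hf0 in
theorem operatorPerspective_dual_le_one_iff (hA : IsStrictlyPositive A)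
    (hB : IsStrictlyPositive B) :
    operatorPerspective (fun t => 1 / f (1 / t)) (A ^ (-1 : ℝ)) (B ^ (-1 : ℝ)) ≤ 1 ↔
      1 ≤ operatorPerspective f A B := by
  rw [operatorPerspective_dual hf hf0 hA hB,
    rpow_neg_one_le_one_iff (isStrictlyPositive_operatorPerspective hf hf0 hA hB)]

theorem rpow_neg_one_rpow_neg_one (hA : IsStrictlyPositive A) :
    (A ^ (-1 : ℝ)) ^ (-1 : ℝ) = A := by
  rw [CFC.rpow_rpow _ _ _ (by norm_num) hA, neg_one_mul, neg_neg, CFC.rpow_one _ hA.nonneg]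

theorem rpow_neg_one_rpow_comm (hA : IsStrictlyPositive A) {p : ℝ} (hp : p ≠ 0) :
    (A ^ (-1 : ℝ)) ^ p = (A ^ p) ^ (-1 : ℝ) := by
  rw [CFC.rpow_rpow _ _ _ (by norm_num) hA, CFC.rpow_rpow _ _ _ hp hA, mul_comm]

variable (H) in
include hf hf0 in
/-- Inversion `(A, B) ↦ (A⁻¹, B⁻¹)` exchanges the two kinds of Ando-Hiai implications. -/
theorem andoHiaiGE_iff_andoHiaiLE_dual {p : ℝ} (hp : 0 < p) :
    AndoHiaiGE H f p ↔ AndoHiaiLE H (fun t => 1 / f (1 / t)) p := by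
  constructor
  · intro h A B hA hB hAB
    have hA' := hA.rpow A (-1)
    have hB' := hB.rpow B (-1)
    rw [← rpow_neg_one_rpow_neg_one hA, ← rpow_neg_one_rpow_neg_one hB,
      operatorPerspective_dual_le_one_iff hf hf0 hA' hB'] at hAB
    have := h _ _ hA' hB' hAB
    rw [← operatorPerspective_dual_le_one_iff hf hf0 (hA'.rpow _ p) (hB'.rpow _ p)] at this
    rwa [rpow_neg_one_rpow_comm hA hp.ne', rpow_neg_one_rpow_comm hB hp.ne',
      rpow_neg_one_rpow_neg_one (hA.rpow A p), rpow_neg_one_rpow_neg_one (hB.rpow B p)] at this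
  · intro h A B hA hB hAB
    rw [← operatorPerspective_dual_le_one_iff hf hf0 hA hB] at hAB
    have := h _ _ (hA.rpow A (-1)) (hB.rpow B (-1)) hAB
    rwa [rpow_neg_one_rpow_comm hA hp.ne', rpow_neg_one_rpow_comm hB hp.ne',
      operatorPerspective_dual_le_one_iff hf hf0 (hA.rpow A p) (hB.rpow B p)] at this

include hf in
theorem operatorPerspective_swap (hA : IsStrictlyPositive A) (hB : IsStrictlyPositive B) :
    operatorPerspective (fun t => f (1 / t)) B A = operatorPerspective (fun t => t * f t) A B := by
  have hC := hB.rpow_conj hA (-(1 / 2))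
  have hE := hA.rpow_conj hB (-(1 / 2))
  have hfE : cfc (fun t => f (1 / t)) (A ^ (-(1 / 2) : ℝ) * B * A ^ (-(1 / 2) : ℝ))
      = cfc f (A ^ (1 / 2 : ℝ) * B ^ (-1 : ℝ) * A ^ (1 / 2 : ℝ)) := by
    rw [← rpow_conj_rpow_neg_one hA hB (neg_add_cancel _), cfc_rpow_arg hE hf]
    simp only [Real.rpow_neg_one, one_div]
  have hfC : cfc (fun t => t * f t) (B ^ (-(1 / 2) : ℝ) * A * B ^ (-(1 / 2) : ℝ))
      = B ^ (-(1 / 2) : ℝ) * A * B ^ (-(1 / 2) : ℝ)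
        * cfc f (B ^ (-(1 / 2) : ℝ) * A * B ^ (-(1 / 2) : ℝ)) := by
    rw [← cfc_mul_cfc_of_continuousOn hC (f := fun t => t) continuousOn_id hf,
      cfc_id' ℝ _ hC.isSelfAdjoint]
  unfold operatorPerspective
  rw [hfE, hfC]
  have hG : IsUnit (A ^ (1 / 2 : ℝ) * B ^ (-(1 / 2) : ℝ)) :=
    (hA.rpow A _).isUnit.mul (hB.rpow B _).isUnit
  have key := cfc_mul_star_self_mul hG hf
  rw [star_mul, star_rpow, star_rpow] at key
  have e1 : B ^ (-1 : ℝ) = B ^ (-(1 / 2) : ℝ) * B ^ (-(1 / 2) : ℝ) := by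
    rw [rpow_mul_rpow hB]; norm_num
  have e2 : A = A ^ (1 / 2 : ℝ) * A ^ (1 / 2 : ℝ) := by
    rw [rpow_mul_rpow hA, add_halves, CFC.rpow_one _ hA.nonneg]
  have e3 : B ^ (-(1 / 2) : ℝ) * B ^ (1 / 2 : ℝ) = 1 := by
    rw [rpow_mul_rpow hB, neg_add_cancel, CFC.rpow_zero _ hB.nonneg]
  have e4 : B ^ (1 / 2 : ℝ) * B ^ (-(1 / 2) : ℝ) = 1 := by
    rw [rpow_mul_rpow hB, add_neg_cancel, CFC.rpow_zero _ hB.nonneg]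
  have e5 : A ^ (1 / 2 : ℝ) * B ^ (-1 : ℝ) * A ^ (1 / 2 : ℝ)
      = A ^ (1 / 2 : ℝ) * B ^ (-(1 / 2) : ℝ) * (B ^ (-(1 / 2) : ℝ) * A ^ (1 / 2 : ℝ)) := by
    rw [e1]; simp only [mul_assoc]
  have e6 : B ^ (-(1 / 2) : ℝ) * A * B ^ (-(1 / 2) : ℝ)
      = B ^ (-(1 / 2) : ℝ) * A ^ (1 / 2 : ℝ) * (A ^ (1 / 2 : ℝ) * B ^ (-(1 / 2) : ℝ)) := by
    nth_rewrite 1 [e2]; simp only [mul_assoc]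
  rw [e5, e6]
  generalize cfc f (A ^ (1 / 2 : ℝ) * B ^ (-(1 / 2) : ℝ)
    * (B ^ (-(1 / 2) : ℝ) * A ^ (1 / 2 : ℝ))) = S at *
  generalize cfc f (B ^ (-(1 / 2) : ℝ) * A ^ (1 / 2 : ℝ)
    * (A ^ (1 / 2 : ℝ) * B ^ (-(1 / 2) : ℝ))) = R at *
  generalize A ^ (1 / 2 : ℝ) = a at *
  generalize B ^ (1 / 2 : ℝ) = b at *
  generalize B ^ (-(1 / 2) : ℝ) = c at *
  calc a * S * a = (b * c) * a * S * a * (c * b) := by rw [e3, e4, one_mul, mul_one]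
    _ = b * (c * a) * (S * (a * c)) * b := by simp only [mul_assoc]
    _ = b * (c * a * (a * c) * R) * b := by rw [key]; simp only [mul_assoc]

variable (H) in
include hf in
theorem andoHiaiLE_comp_one_div_iff (p : ℝ) :
    AndoHiaiLE H (fun t => f (1 / t)) p ↔ AndoHiaiLE H (fun t => t * f t) p := by
  constructor
  · intro h A B hA hB hAB
    rw [← operatorPerspective_swap hf hA hB] at hAB
    rw [← operatorPerspective_swap hf (hA.rpow A p) (hB.rpow B p)]
    exact h B A hB hA hAB
  · intro h A B hA hB hAB
    rw [operatorPerspective_swap hf hB hA] at hAB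
    rw [operatorPerspective_swap hf (hB.rpow B p) (hA.rpow A p)]
    exact h B A hB hA hAB

theorem algebraMap_rpow {r : ℝ} (hr : 0 ≤ r) (x : ℝ) :
    (algebraMap ℝ (H →L[ℂ] H) r) ^ x = algebraMap ℝ (H →L[ℂ] H) (r ^ x) := by
  have h0 : 0 ≤ algebraMap ℝ (H →L[ℂ] H) r := by
    rw [Algebra.algebraMap_eq_smul_one]
    exact smul_nonneg hr zero_le_one
  rw [CFC.rpow_eq_cfc_real h0, cfc_algebraMap]

theorem operatorPerspective_algebraMap (f : ℝ → ℝ) {a b : ℝ} (hb : 0 < b) :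
    operatorPerspective f (algebraMap ℝ (H →L[ℂ] H) a) (algebraMap ℝ (H →L[ℂ] H) b)
      = algebraMap ℝ (H →L[ℂ] H) (b * f (a / b)) := by
  unfold operatorPerspective
  rw [algebraMap_rpow hb.le, algebraMap_rpow hb.le, ← map_mul, ← map_mul, cfc_algebraMap,
    ← map_mul, ← map_mul]
  congr 1
  have h1 : b ^ (-(1 / 2) : ℝ) * a * b ^ (-(1 / 2) : ℝ) = a / b := by
    rw [mul_comm, ← mul_assoc, ← Real.rpow_add hb]
    norm_num [Real.rpow_neg_one]
    ring
  have h2 : b ^ (1 / 2 : ℝ) * b ^ (1 / 2 : ℝ) = b := by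
    rw [← Real.rpow_add hb]; norm_num
  rw [h1, mul_right_comm, h2]

theorem one_le_algebraMap_iff [Nontrivial H] (r : ℝ) :
    1 ≤ algebraMap ℝ (H →L[ℂ] H) r ↔ 1 ≤ r := by
  rw [← map_one (algebraMap ℝ (H →L[ℂ] H)), algebraMap_le_algebraMap]

/-- The Ando-Hiai implication for scalar multiples of the identity. -/
theorem AndoHiaiGE.one_le_mul [Nontrivial H] {p : ℝ} (h : AndoHiaiGE H f p) {t b : ℝ} (ht : 0 < t)
    (hb : 0 < b) (h1 : 1 ≤ b * f t) : 1 ≤ b ^ p * f (t ^ p) := by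
  have hA : IsStrictlyPositive (algebraMap ℝ (H →L[ℂ] H) (t * b)) :=
    isStrictlyPositive_algebraMap (mul_pos ht hb)
  have hB : IsStrictlyPositive (algebraMap ℝ (H →L[ℂ] H) b) := isStrictlyPositive_algebraMap hb
  have := h _ _ hA hB (by
    rw [operatorPerspective_algebraMap f hb, one_le_algebraMap_iff, mul_div_cancel_right₀ _ hb.ne']
    exact h1)
  rwa [algebraMap_rpow (mul_pos ht hb).le, algebraMap_rpow hb.le,
    operatorPerspective_algebraMap f (Real.rpow_pos_of_pos hb p), one_le_algebraMap_iff,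
    Real.mul_rpow ht.le hb.le, mul_div_cancel_right₀ _ (Real.rpow_pos_of_pos hb p).ne'] at this

theorem AndoHiaiGE.of_rpow_one_div {p : ℝ} (hp : 0 < p) {n : ℕ} (hn : n ≠ 0)
    (h : AndoHiaiGE H f (p ^ (1 / n : ℝ))) : AndoHiaiGE H f p := by
  set r := p ^ (1 / n : ℝ) with hr
  have hr0 : 0 < r := Real.rpow_pos_of_pos hp _
  have hrn : r ^ n = p := by
    rw [hr, ← Real.rpow_natCast, ← Real.rpow_mul hp.le, one_div_mul_cancel (by exact_mod_cast hn),
      Real.rpow_one]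
  rw [← hrn]
  clear_value r
  clear hn hrn hr
  induction n with
  | zero =>
    intro A B hA hB hAB
    simpa [CFC.rpow_one _ hA.nonneg, CFC.rpow_one _ hB.nonneg] using hAB
  | succ n ih =>
    intro A B hA hB hAB
    have hrn : (r ^ n : ℝ) ≠ 0 := (pow_pos hr0 n).ne'
    have := h _ _ (hA.rpow A (r ^ n)) (hB.rpow B (r ^ n)) (ih A B hA hB hAB)
    rwa [CFC.rpow_rpow _ _ _ hrn hA, CFC.rpow_rpow _ _ _ hrn hB, ← pow_succ] at this

end Perspective

section PowerBounds

variable {H : Type*} [NormedAddCommGroup H] [InnerProductSpace ℂ H] [CompleteSpace H]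
  {A B C : H →L[ℂ] H} {k : ℝ → ℝ} (hk : ContinuousOn k (Ioi 0)) (hk0 : ∀ t, 0 < t → 0 < k t)

theorem rpow_half_mul_cfc_mul_rpow_half (hC : IsStrictlyPositive C) {g : ℝ → ℝ}
    (hg : ContinuousOn g (Ioi 0)) :
    C ^ (1 / 2 : ℝ) * cfc g C * C ^ (1 / 2 : ℝ) = cfc (fun t => t * g t) C := by
  have h1 := continuousOn_rpow_Ioi (1 / 2)
  rw [CFC.rpow_eq_cfc_real hC.nonneg, cfc_mul_cfc_of_continuousOn hC h1 hg,
    cfc_mul_cfc_of_continuousOn hC (f := fun t => t ^ (1 / 2 : ℝ) * g t) (h1.mul hg) h1]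
  refine cfc_congr_of_pos hC fun t ht => ?_
  rw [mul_right_comm, ← Real.rpow_add ht, add_halves, Real.rpow_one]

theorem rpow_half_conj_rpow (hB : IsStrictlyPositive B) (hA : IsStrictlyPositive A) {q : ℝ}
    (hq : q + 1 ≠ 0) :
    (B ^ (q + 1)) ^ (-(1 / 2) : ℝ) * A ^ (q + 1) * (B ^ (q + 1)) ^ (-(1 / 2) : ℝ)
      = B ^ (-(q / 2)) *
        ((B ^ (-(1 / 2) : ℝ) * A * B ^ (-(1 / 2) : ℝ)) ^ (1 / 2 : ℝ)
          * ((B ^ (-(1 / 2) : ℝ) * A * B ^ (-(1 / 2) : ℝ)) ^ (1 / 2 : ℝ) * B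
            * (B ^ (-(1 / 2) : ℝ) * A * B ^ (-(1 / 2) : ℝ)) ^ (1 / 2 : ℝ)) ^ q
          * (B ^ (-(1 / 2) : ℝ) * A * B ^ (-(1 / 2) : ℝ)) ^ (1 / 2 : ℝ)) * B ^ (-(q / 2)) := by
  have hC := hB.rpow_conj hA (-(1 / 2))
  have h1 := rpow_conj_rpow_eq hB hC q
  rw [rpow_conj_cancel hB (add_neg_cancel _)] at h1
  rw [h1, CFC.rpow_rpow _ _ _ hq hB, rpow_conj_rpow_conj hB,
    show (q + 1) * -(1 / 2) + 1 / 2 = -(q / 2) by ring]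

theorem rpow_conj_rpow_eq_one (hB : IsStrictlyPositive B) {q r : ℝ}
    (hr : -(q / 2) + r + -(q / 2) = 0) : B ^ (-(q / 2)) * B ^ r * B ^ (-(q / 2)) = 1 := by
  rw [rpow_mul_rpow hB, rpow_mul_rpow hB, hr, CFC.rpow_zero _ hB.nonneg]

include hk hk0

theorem rpow_half_conj_cfc_rpow (hC : IsStrictlyPositive C) (q : ℝ) :
    C ^ (1 / 2 : ℝ) * (C ^ (1 / 2 : ℝ) * cfc k C * C ^ (1 / 2 : ℝ)) ^ q * C ^ (1 / 2 : ℝ)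
      = cfc (fun t => k t ^ q * t ^ (q + 1)) C := by
  have h1 : ContinuousOn (fun t => t * k t) (Ioi 0) := continuousOn_id.mul hk
  have h2 : ∀ t, 0 < t → 0 < t * k t := fun t ht => mul_pos ht (hk0 t ht)
  rw [rpow_half_mul_cfc_mul_rpow_half hC hk, cfc_rpow_of_continuousOn hC h1 h2,
    rpow_half_mul_cfc_mul_rpow_half hC (h1.rpow_of_pos h2 q)]
  refine cfc_congr_of_pos hC fun t ht => ?_
  rw [Real.mul_rpow ht.le (hk0 t ht).le, Real.rpow_add ht, Real.rpow_one]
  ring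

theorem star_mul_cfc_mul (hC : IsStrictlyPositive C) (q : ℝ) {g : ℝ → ℝ}
    (hg : ContinuousOn g (Ioi 0)) :
    star (cfc (fun t => k t ^ (q / 2)) C * B ^ (-(q / 2))) * cfc g C
        * (cfc (fun t => k t ^ (q / 2)) C * B ^ (-(q / 2)))
      = B ^ (-(q / 2)) * cfc (fun t => k t ^ q * g t) C * B ^ (-(q / 2)) := by
  have h1 := hk.rpow_of_pos hk0 (q / 2)
  have h2 : cfc (fun t => k t ^ q * g t) C
      = cfc (fun t => k t ^ (q / 2)) C * cfc g C * cfc (fun t => k t ^ (q / 2)) C := by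
    rw [cfc_mul_cfc_of_continuousOn hC h1 hg,
      cfc_mul_cfc_of_continuousOn hC (f := fun t => k t ^ (q / 2) * g t) (h1.mul hg) h1]
    refine cfc_congr_of_pos hC fun t ht => ?_
    rw [mul_right_comm, ← Real.rpow_add (hk0 t ht), add_halves]
  rw [h2, star_mul, star_rpow, (IsSelfAdjoint.cfc (f := fun t => k t ^ (q / 2))).star_eq]
  simp only [mul_assoc]

theorem star_mul_self_eq (hC : IsStrictlyPositive C) (q : ℝ) :
    star (cfc (fun t => k t ^ (q / 2)) C * B ^ (-(q / 2)))
        * (cfc (fun t => k t ^ (q / 2)) C * B ^ (-(q / 2)))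
      = B ^ (-(q / 2)) * cfc k C ^ q * B ^ (-(q / 2)) := by
  have := star_mul_cfc_mul (B := B) hk hk0 hC q (g := fun _ => 1) continuousOn_const
  rw [cfc_const_one ℝ C hC.isSelfAdjoint, mul_one, funext fun t => mul_one (k t ^ q)] at this
  rw [this, cfc_rpow_of_continuousOn hC hk hk0]

end PowerBounds

section Main

variable {H : Type u} [NormedAddCommGroup H] [InnerProductSpace ℂ H] [CompleteSpace H]
  [Nontrivial H] {h : ℝ → ℝ}

theorem IsPMI.andoHiaiGE_of_le_two (hh : IsOMPosOne.{u} h) (hp : IsPMI h) {p : ℝ} (hp1 : 1 ≤ p)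
    (hp2 : p ≤ 2) : AndoHiaiGE H h p := by
  intro A B hA hB hAB
  have hc := hh.operatorMonotone.1
  obtain ⟨q, rfl⟩ : ∃ q, p = q + 1 := ⟨p - 1, by ring⟩
  have hq0 : 0 ≤ q := by linarith
  have hq1 : q ≤ 1 := by linarith
  have hk := hc.one_div_of_pos hh.pos
  have hk0 : ∀ t, 0 < t → 0 < 1 / h t := fun t ht => one_div_pos.2 (hh.pos t ht)
  have hC := hB.rpow_conj hA (-(1 / 2))
  have hAB' := hAB
  rw [show h = fun t => 1 / (1 / h t) by simp only [one_div_one_div],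
    one_le_operatorPerspective_one_div_iff hk hk0 hA hB] at hAB'
  have hAp := hA.rpow A (q + 1)
  have hBp := hB.rpow B (q + 1)
  have hZ := hBp.rpow_conj hAp (-(1 / 2))
  have hZeq := rpow_half_conj_rpow hB hA (q := q) (by linarith)
  unfold operatorPerspective at hAB ⊢
  set C := B ^ (-(1 / 2) : ℝ) * A * B ^ (-(1 / 2) : ℝ) with hCdef
  set Z := (B ^ (q + 1)) ^ (-(1 / 2) : ℝ) * A ^ (q + 1) * (B ^ (q + 1)) ^ (-(1 / 2) : ℝ)
  set k : ℝ → ℝ := fun t => 1 / h t with hkdef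
  have hgc : ContinuousOn (fun t => h (t ^ (q + 1))) (Ioi 0) :=
    hc.comp (continuousOn_rpow_Ioi _) fun t ht => Real.rpow_pos_of_pos ht _
  have key := hh.conj_cfc_le_cfc (X := cfc (fun t => k t ^ (q / 2)) C * B ^ (-(q / 2)))
    (hC.rpow C (q + 1)) hZ ?_ ?_
  · rw [cfc_rpow_arg hC hc, star_mul_cfc_mul hk hk0 hC q hgc] at key
    have h1 := rpow_conj_le_rpow_conj B ((q + 1) / 2) key
    have h2 : cfc h C ≤ cfc (fun t => k t ^ q * h (t ^ (q + 1))) C := by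
      refine cfc_mono_of_pos hC hc ((hk.rpow_of_pos hk0 q).mul hgc) fun t ht => ?_
      have hht := hh.pos t ht
      calc h t = k t ^ q * h t ^ (q + 1) := by
            rw [hkdef, Real.rpow_add hht, Real.rpow_one, ← mul_assoc,
              ← Real.mul_rpow (hk0 t ht).le hht.le, one_div_mul_cancel hht.ne', Real.one_rpow,
              one_mul]
        _ ≤ _ := mul_le_mul_of_nonneg_left (hp t ht _ hp1)
            (Real.rpow_nonneg (hk0 t ht).le _)
    rw [rpow_conj_rpow_conj hB, show (q + 1) / 2 + -(q / 2) = 1 / 2 by ring] at h1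
    rw [CFC.rpow_rpow _ _ _ (by linarith) hB, mul_one_div]
    exact (hAB.trans (rpow_conj_le_rpow_conj B _ h2)).trans h1
  · rw [star_mul_self_eq hk hk0 hC, ← rpow_conj_rpow_eq_one hB (q := q) (r := q) (by ring)]
    exact rpow_conj_le_rpow_conj B _ (CFC.rpow_le_rpow ⟨hq0, hq1⟩ hAB')
  · rw [CFC.rpow_eq_cfc_real hC.nonneg, star_mul_cfc_mul hk hk0 hC q (continuousOn_rpow_Ioi _),
      ← rpow_half_conj_cfc_rpow hk hk0 hC, hZeq]
    refine rpow_conj_le_rpow_conj B _ (rpow_conj_le_rpow_conj C _ ?_)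
    exact CFC.rpow_le_rpow ⟨hq0, hq1⟩ (rpow_conj_le_rpow_conj C _ hAB')

theorem IsPMI.map_rpow_le (hh : ∀ t, 0 < t → 0 < h t) (hp : IsPMI h) {p : ℝ} (hp0 : 0 < p)
    (hp1 : p ≤ 1) {t : ℝ} (ht : 0 < t) : h (t ^ p) ≤ h t ^ p := by
  have h1 := hp (t ^ p) (Real.rpow_pos_of_pos ht p) p⁻¹ ((one_le_inv₀ hp0).2 hp1)
  rw [← Real.rpow_mul ht.le, mul_inv_cancel₀ hp0.ne', Real.rpow_one] at h1
  have hpos := hh _ (Real.rpow_pos_of_pos ht p)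
  have h2 := Real.rpow_le_rpow (Real.rpow_nonneg hpos.le _) h1 hp0.le
  rwa [← Real.rpow_mul hpos.le, inv_mul_cancel₀ hp0.ne', Real.rpow_one] at h2

theorem IsPMI.andoHiaiGE_one_div_of_half_le (hh : IsOMPosOne.{u} h) (hp : IsPMI h) {p : ℝ}
    (hp1 : 1 / 2 ≤ p) (hp2 : p ≤ 1) : AndoHiaiGE H (fun t => 1 / h t) p := by
  intro A B hA hB hAB
  have hk := hh.operatorMonotone.1
  have hk0 := hh.pos
  obtain ⟨q, rfl⟩ : ∃ q, p = q + 1 := ⟨p - 1, by ring⟩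
  have hq0 : q ≤ 0 := by linarith
  have hq1 : -1 ≤ q := by linarith
  have hC := hB.rpow_conj hA (-(1 / 2))
  have hAp := hA.rpow A (q + 1)
  have hBp := hB.rpow B (q + 1)
  have hZ := hBp.rpow_conj hAp (-(1 / 2))
  rw [one_le_operatorPerspective_one_div_iff hk hk0 hA hB] at hAB
  rw [one_le_operatorPerspective_one_div_iff hk hk0 hAp hBp]
  have hZeq := rpow_half_conj_rpow hB hA (q := q) (by linarith)
  set C := B ^ (-(1 / 2) : ℝ) * A * B ^ (-(1 / 2) : ℝ) with hCdef
  set Z := (B ^ (q + 1)) ^ (-(1 / 2) : ℝ) * A ^ (q + 1) * (B ^ (q + 1)) ^ (-(1 / 2) : ℝ)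
  have hgc : ContinuousOn (fun t => h (t ^ (q + 1))) (Ioi 0) :=
    hk.comp (continuousOn_rpow_Ioi _) fun t ht => Real.rpow_pos_of_pos ht _
  have hhC := hC.cfc_of_pos hk hk0
  have hXu : IsUnit (cfc (fun t => h t ^ (q / 2)) C * B ^ (-(q / 2))) :=
    (hC.cfc_of_pos (hk.rpow_of_pos hk0 _)
      fun t ht => Real.rpow_pos_of_pos (hk0 t ht) _).isUnit.mul (hB.rpow B _).isUnit
  have key := hh.cfc_le_conj_cfc (hC.rpow C (q + 1)) hZ hXu ?_ ?_
  · rw [cfc_rpow_arg hC hk, star_mul_cfc_mul hk hk0 hC q hgc] at key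
    have h2 : cfc (fun t => h t ^ q * h (t ^ (q + 1))) C ≤ B ^ (2 * q + 1) := by
      refine le_trans ?_ (CFC.rpow_le_rpow ⟨by linarith, by linarith⟩ hAB)
      rw [cfc_rpow_of_continuousOn hC hk hk0]
      refine cfc_mono_of_pos hC ((hk.rpow_of_pos hk0 q).mul hgc) (hk.rpow_of_pos hk0 _)
        fun t ht => ?_
      rw [show 2 * q + 1 = q + (q + 1) by ring, Real.rpow_add (hk0 t ht)]
      exact mul_le_mul_of_nonneg_left (hp.map_rpow_le hk0 (by linarith) hp2 ht)
        (Real.rpow_nonneg (hk0 t ht).le _)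
    refine key.trans ((rpow_conj_le_rpow_conj B _ h2).trans_eq ?_)
    rw [rpow_mul_rpow hB, rpow_mul_rpow hB]
    congr 1
    ring
  · rw [star_mul_self_eq hk hk0 hC, ← rpow_conj_rpow_eq_one hB (q := q) (r := q) (by ring)]
    exact rpow_conj_le_rpow_conj B _ (rpow_le_rpow_of_nonpos hhC hAB hq1 hq0)
  · rw [CFC.rpow_eq_cfc_real hC.nonneg, star_mul_cfc_mul hk hk0 hC q (continuousOn_rpow_Ioi _),
      ← rpow_half_conj_cfc_rpow hk hk0 hC, hZeq]
    refine rpow_conj_le_rpow_conj B _ (rpow_conj_le_rpow_conj C _ ?_)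
    exact rpow_le_rpow_of_nonpos (hC.rpow_conj hhC _) (rpow_conj_le_rpow_conj C _ hAB) hq1 hq0

theorem IsPMI.andoHiaiGE (hh : IsOMPosOne.{u} h) (hp : IsPMI h) {p : ℝ} (hp1 : 1 ≤ p) :
    AndoHiaiGE H h p := by
  obtain ⟨n, hn⟩ := pow_unbounded_of_one_lt p (one_lt_two)
  have hp0 : 0 < p := by linarith
  have hn0 : n ≠ 0 := by
    rintro rfl
    rw [pow_zero] at hn
    linarith
  refine AndoHiaiGE.of_rpow_one_div hp0 hn0
    (hp.andoHiaiGE_of_le_two hh (Real.one_le_rpow hp1 (by positivity)) ?_)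
  calc p ^ (1 / n : ℝ) ≤ ((2 : ℝ) ^ n) ^ (1 / n : ℝ) :=
        Real.rpow_le_rpow hp0.le hn.le (by positivity)
    _ = 2 := by rw [one_div, Real.pow_rpow_inv_natCast (by norm_num) hn0]

theorem IsPMI.andoHiaiGE_one_div (hh : IsOMPosOne.{u} h) (hp : IsPMI h) {p : ℝ} (hp0 : 0 < p)
    (hp1 : p ≤ 1) : AndoHiaiGE H (fun t => 1 / h t) p := by
  obtain ⟨n, hn⟩ := exists_pow_lt_of_lt_one hp0 (one_half_lt_one (α := ℝ))
  have hn0 : n ≠ 0 := by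
    rintro rfl
    rw [pow_zero] at hn
    linarith
  refine AndoHiaiGE.of_rpow_one_div hp0 hn0
    (hp.andoHiaiGE_one_div_of_half_le hh ?_ (Real.rpow_le_one hp0.le hp1 (by positivity)))
  calc (1 / 2 : ℝ) = ((1 / 2 : ℝ) ^ n) ^ (1 / n : ℝ) := by
        rw [one_div (n : ℝ), Real.pow_rpow_inv_natCast (by norm_num) hn0]
    _ ≤ p ^ (1 / n : ℝ) := Real.rpow_le_rpow (by positivity) hn.le (by positivity)

theorem isPMI_of_andoHiaiGE (hh : ∀ t, 0 < t → 0 < h t)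
    (hA : ∀ p : ℝ, 1 ≤ p → AndoHiaiGE H h p) : IsPMI h := by
  intro t ht p hp
  have hht := hh t ht
  have := (hA p hp).one_le_mul ht (inv_pos.2 hht) (inv_mul_cancel₀ hht.ne').ge
  rwa [Real.inv_rpow hht.le, inv_mul_eq_div, one_le_div (Real.rpow_pos_of_pos hht p)] at this

theorem isPMI_of_andoHiaiGE_one_div (hh : ∀ t, 0 < t → 0 < h t)
    (hA : ∀ p : ℝ, 0 < p → p ≤ 1 → AndoHiaiGE H (fun t => 1 / h t) p) : IsPMI h := by
  intro t ht p hp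
  have hp0 : 0 < p := by linarith
  have htp := Real.rpow_pos_of_pos ht p
  have hht := hh _ htp
  have := (hA p⁻¹ (inv_pos.2 hp0) (inv_le_one_of_one_le₀ hp)).one_le_mul htp hht
    (mul_one_div_cancel hht.ne').ge
  rw [← Real.rpow_mul ht.le, mul_inv_cancel₀ hp0.ne', Real.rpow_one, mul_one_div,
    one_le_div (hh t ht)] at this
  have h2 := Real.rpow_le_rpow (hh t ht).le this hp0.le
  rwa [← Real.rpow_mul hht.le, inv_mul_cancel₀ hp0.ne', Real.rpow_one] at h2

variable (H) in
theorem tfae_isPMI (hh : IsOMPosOne.{u} h) :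
    List.TFAE
      [IsPMI h,
       ∀ p : ℝ, 1 ≤ p → AndoHiaiGE H h p,
       ∀ p : ℝ, 0 < p → p ≤ 1 → AndoHiaiGE H (fun t => 1 / h t) p,
       ∀ p : ℝ, 0 < p → p ≤ 1 → AndoHiaiLE H (fun t => h (1 / t)) p,
       ∀ p : ℝ, 0 < p → p ≤ 1 → AndoHiaiLE H (fun t => t * h t) p] := by
  have hc := hh.operatorMonotone.1
  tfae_have 1 → 2 := fun hp p hp1 => hp.andoHiaiGE hh hp1
  tfae_have 2 → 1 := isPMI_of_andoHiaiGE hh.pos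
  tfae_have 1 → 3 := fun hp p hp0 hp1 => hp.andoHiaiGE_one_div hh hp0 hp1
  tfae_have 3 → 1 := isPMI_of_andoHiaiGE_one_div hh.pos
  tfae_have 3 ↔ 4 := by
    refine forall₂_congr fun p hp0 => imp_congr_right fun _ => ?_
    simpa only [one_div_one_div] using andoHiaiGE_iff_andoHiaiLE_dual H
      (hc.one_div_of_pos hh.pos) (fun t ht => one_div_pos.2 (hh.pos t ht)) hp0
  tfae_have 4 ↔ 5 :=
    forall₂_congr fun p _ => imp_congr_right fun _ => andoHiaiLE_comp_one_div_iff H hc p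
  tfae_finish

end Main

theorem IsOMPosOne.dual {h : ℝ → ℝ} (hh : IsOMPosOne.{u} h) :
    IsOMPosOne.{u} (fun t => 1 / h (1 / t)) := by
  have hc := hh.operatorMonotone.1
  have hc' := hc.comp_one_div
  have hpos : ∀ t, 0 < t → 0 < h (1 / t) := fun t ht => hh.pos _ (one_div_pos.2 ht)
  refine ⟨⟨hc'.one_div_of_pos hpos, ?_⟩, fun t ht => one_div_pos.2 (hpos t ht), by
    simp [hh.map_one]⟩
  intro K _ _ _ hK A B hA hAB
  have hB := hA.of_le hAB
  have key : ∀ S : K →L[ℂ] K, IsStrictlyPositive S →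
      cfc (fun t => 1 / h (1 / t)) S = cfc h (S ^ (-1 : ℝ)) ^ (-1 : ℝ) := by
    intro S hS
    rw [cfc_rpow_of_continuousOn (hS.rpow S _) hc hh.pos,
      cfc_rpow_arg hS (hc.rpow_of_pos hh.pos _)]
    simp only [Real.rpow_neg_one, one_div]
  rw [key A hA, key B hB,
    rpow_neg_one_le_rpow_neg_one_iff ((hA.rpow A _).cfc_of_pos hc hh.pos)
      ((hB.rpow B _).cfc_of_pos hc hh.pos)]
  exact hh.operatorMonotone.2 K hK _ _ (hB.rpow B _)
    (CStarAlgebra.rpow_neg_one_le_rpow_neg_one hAB hA)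

theorem isPMI_dual_iff_isPMD {h : ℝ → ℝ} (hh : ∀ t, 0 < t → 0 < h t) :
    IsPMI (fun t => 1 / h (1 / t)) ↔ IsPMD h := by
  have key : ∀ t, 0 < t → ∀ p : ℝ, (1 / h (1 / t)) ^ p ≤ 1 / h (1 / t ^ p) ↔
      h ((1 / t) ^ p) ≤ h (1 / t) ^ p := by
    intro t ht p
    have h1 := hh _ (one_div_pos.2 ht)
    have h2 := hh _ (Real.rpow_pos_of_pos (one_div_pos.2 ht) p)
    rw [Real.div_rpow zero_le_one h1.le, Real.one_rpow, one_div (t ^ p), ← Real.inv_rpow ht.le,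
      ← one_div t, one_div_le_one_div (Real.rpow_pos_of_pos h1 p) h2]
  constructor
  · intro hI t ht p hp
    simpa only [one_div_one_div] using
      (key _ (one_div_pos.2 ht) p).1 (hI _ (one_div_pos.2 ht) p hp)
  · exact fun hD t ht p hp => (key t ht p).2 (hD _ (one_div_pos.2 ht) p hp)

theorem theorem3p7 (H : Type u) [NormedAddCommGroup H] [InnerProductSpace ℂ H]
    [CompleteSpace H] [Nontrivial H] (h : ℝ → ℝ) (hh : IsOMPosOne.{u} h) :
    List.TFAE
      [IsPMI h,
       ∀ p : ℝ, 1 ≤ p → AndoHiaiGE H h p,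
       ∀ p : ℝ, 0 < p → p ≤ 1 → AndoHiaiGE H (fun t => 1 / h t) p,
       ∀ p : ℝ, 0 < p → p ≤ 1 → AndoHiaiLE H (fun t => h (1 / t)) p,
       ∀ p : ℝ, 0 < p → p ≤ 1 → AndoHiaiLE H (fun t => t * h t) p] ∧
    List.TFAE
      [IsPMD h,
       ∀ p : ℝ, 1 ≤ p → AndoHiaiLE H h p,
       ∀ p : ℝ, 0 < p → p ≤ 1 → AndoHiaiLE H (fun t => 1 / h t) p,
       ∀ p : ℝ, 0 < p → p ≤ 1 → AndoHiaiGE H (fun t => h (1 / t)) p,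
       ∀ p : ℝ, 0 < p → p ≤ 1 → AndoHiaiGE H (fun t => t * h t) p] := by
  refine ⟨tfae_isPMI H hh, ?_⟩
  have hc := hh.operatorMonotone.1
  have hk := hh.dual
  have hkc := hk.operatorMonotone.1
  have e1 := isPMI_dual_iff_isPMD hh.pos
  have e2 : (∀ p : ℝ, 1 ≤ p → AndoHiaiGE H (fun t => 1 / h (1 / t)) p) ↔
      ∀ p : ℝ, 1 ≤ p → AndoHiaiLE H h p := by
    refine forall₂_congr fun p hp => ?_
    simpa only [one_div_one_div] using
      andoHiaiGE_iff_andoHiaiLE_dual H hkc hk.pos (zero_lt_one.trans_le hp)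
  have e5 : (∀ p : ℝ, 0 < p → p ≤ 1 → AndoHiaiLE H (fun t => t * (1 / h (1 / t))) p) ↔
      ∀ p : ℝ, 0 < p → p ≤ 1 → AndoHiaiGE H (fun t => t * h t) p := by
    refine forall₂_congr fun p hp => imp_congr_right fun _ => ?_
    have hth : ContinuousOn (fun t => t * h t) (Ioi 0) := continuousOn_id.mul hc
    have := andoHiaiGE_iff_andoHiaiLE_dual H hth (fun t ht => mul_pos ht (hh.pos t ht)) hp
    rw [this]
    simp only [one_div, mul_inv, inv_inv]
  have := tfae_isPMI H hk
  simp only [one_div_one_div] at this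
  rw [e1, e2, e5] at this
  tfae_have 1 ↔ 2 := this.out 0 1
  tfae_have 1 ↔ 3 := this.out 0 3
  tfae_have 1 ↔ 4 := this.out 0 2
  tfae_have 1 ↔ 5 := this.out 0 4
  tfae_finish
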